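/- Let $\mathcal S=[0,1]$, let $x_1,\dots,x_J$ be distinct real observation points, $\mathcal X=\{x_1,\dots,x_J\}$, let $\nu$ be the atomic measure with $\nu(\{x_j\})=1/J$, and $\mathbb Y=L^2_\nu(\mathcal X)$. Let $u_1,\dots,u_{n_0}$ be input functions, and let $g[u_k]:\mathcal X\times\mathcal S\to\mathbb R$ be given functions with $g[u_k]\in L^2(\mathcal X\times\mathcal S)$ (with respect to $\nu\otimes ds$) and $$\max_{k}\sup_{x\in\mathcal X,\,s\in\mathcal S}|g[u_k](x,s)|<\infty .$$ Put $R_\phi[u](x)=\int_{\mathcal S}\phi(s)\,g[u](x,s)\,ds$. Assume that $Z=\frac1{n_0}\sum_{k}\int_{\mathcal S}\int_{\mathcal X}|g[u_k](x,s)|\,\nu(dx)\,ds>0$ and let $\rho$ be the measure on $\mathcal S$ with Lebesgue density $\dot\rho(s)=\frac1{n_0Z}\sum_{k}\int_{\mathcal X}|g[u_k](x,s)|\,\nu(dx)$. Let $$G(s,s')=\frac1{n_0}\sum_{k}\int_{\mathcal X}g[u_k](x,s)g[u_k](x,s')\,\nu(dx),\qquad \overline G(s,s')=\frac{G(s,s')}{\dot\rho(s)\dot\rho(s')}\mathbf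 1_{\{\dot\rho(s)\dot\rho(s')>0\}} .$$ For outputs $f_1,\dots,f_{n_0}:\mathcal X\to\mathbb R$ let $$\mathcal E_{\mathcal D}(\phi)=\frac1{n_0}\sum_{k=1}^{n_0}\sum_{j=1}^{J}|R_\phi[u_k](x_j)-f_k(x_j)|^2\,\frac1J .$$ For $\phi\in L^2_\rho$ the integrals $R_\phi[u_k](x_j)$ converge absolutely and depend only on the $\rho$-a.e. class of $\phi$. Moreover: (a) $\overline G$ is symmetric and lies in $L^2_{\rho\otimes\rho}$. The formula $\mathcal L_{\overline G}\phi(s)=\int_{\mathcal S}\phi(s')\overline G(s,s')\,\rho(ds')$ defines a bounded operator on $L^2_\rho$ that is compact, self-adjoint and positive (that is, $\langle\mathcal L_{\overline G}\phi,\phi\rangle\ge0$). Its eigenvalues are nonnegative, and $L^2_\rho$ has a countable complete orthonormal basis $\{\psi_i\}$ of eigenfunctions, $\mathcal L_{\overline G}\psi_i=\lambda_i\psi_i$. (b) For all outputs $(f_k)$ there is $\phi^D\in L^2_\rho$ with $\langle\phi^D,\phi\rangle_{L^2_\rho}=\frac1{n_0}\sum_k\langle R_\phi[u_k],f_k\rangle_{\mathbb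 Y}$ for all $\phi\in L^2_\rho$, and $$\mathcal E_{\mathcal D}(\phi)=\langle\mathcal L_{\overline G}\phi,\phi\rangle_{L^2_\rho}-2\langle\phi^D,\phi\rangle_{L^2_\rho}+\mathrm{const}\qquad(\phi\in L^2_\rho),$$ with a constant independent of $\phi$. Let $H=\mathcal N(\mathcal L_{\overline G})^\perp$; then $H=\overline{\mathrm{span}\{\psi_i:\lambda_i>0\}}$ for every orthonormal eigenbasis. If the data are noiseless, $f_k(x_j)=R_{\phi_*}[u_k](x_j)$ for all $k,j$ with some $\phi_*\in L^2_\rho$, then $\phi^D=\mathcal L_{\overline G}\phi_*$, and $\mathcal E_{\mathcal D}$ has a unique minimizer in $H$, namely $\mathcal L_{\overline G}^{-1}\phi^D=P_H(\phi_*)$, where $\mathcal L_{\overline G}^{-1}$ is the inverse of $\mathcal L_{\overline G}|_H$ and $P_H$ the orthogonal projection onto $H$. (c) Let $\mathcal L_{\overline G}^{1/2}$ be the positive square root, let $H_{\overline G}=\mathcal L_{\overline G}^{1/2}(L^2_\rho)$ with inner product $\langle\phi,\phi'\rangle_{H_{\overline G}}=\langle\mathcal L_{\overline G}^{-1/2}\phi,\mathcal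 L_{\overline G}^{-1/2}\phi'\rangle_{L^2_\rho}$, where $\mathcal L_{\overline G}^{-1/2}\phi$ is the preimage of $\phi$ under $\mathcal L_{\overline G}^{1/2}$ in $\mathcal N(\mathcal L_{\overline G}^{1/2})^\perp$. There is a Hilbert space $F$ of functions on $\mathcal S$ with reproducing kernel $\overline G$ (the RKHS of $\overline G$). Every function in $F$ is in $L^2_\rho$, the set of $\rho$-a.e. classes of functions in $F$ is $H_{\overline G}$, and $$\|\phi\|^2_{H_{\overline G}}=\min\{\|h\|_F^2: h\in F,\ h=\phi\ \rho\text{-a.e.}\}\qquad(\phi\in H_{\overline G}).$$ If all functions $g[u_k](x_j,\cdot)$ are continuous on $\mathcal S$, then two elements of $F$ that agree $\rho$-a.e. are equal, and the map from a function to its class is an isometric isomorphism of $F$ onto $H_{\overline G}$: inner products in $F$ and in $H_{\overline G}$ coincide. Finally, $H=\overline{H_{\overline G}}$ with closure in $L^2_\rho$, and for all $\phi\in H_{\overline G}$ and $\psi\in L^2_\rho$ one has $\mathcal L_{\overline G}\psi\in H_{\overline G}$ and $\langle\phi,\mathcal L_{\overline G}\psi\rangle_{H_{\overline G}}=\langle\phi,\psi\rangle_{L^2_\rho}$.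 -/

import Mathlib

open MeasureTheory Filter
open scoped ENNReal unitInterval

noncomputable section

namespace KernelLearning

/-- The observation setting: an operator family `R_φ[u](x) = ∫_S φ(s) g[u](x,s) ds` on `S = [0,1]`
given through the functional `g`, input functions `u_1, …, u_{n₀}` from an input space `𝕏`, and
distinct observation points `x_1, …, x_J`. -/
structure Observation (𝕏 : Type*) where
  /-- number of input functions -/
  n₀ : ℕ
  /-- number of observation points -/
  J : ℕ
  /-- the functional `g[u](x, s)` -/
  g : 𝕏 → ℝ → I → ℝ
  /-- the input functions -/
  u : Fin n₀ → 𝕏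
  /-- the observation points, `X = {x_1, …, x_J}` -/
  x : Fin J → ℝ
  x_injective : Function.Injective x

namespace Observation

variable {𝕏 : Type*} (D : Observation 𝕏)

/-- The atomic measure `ν` on the observation points, `ν({x_j}) = 1/J`. -/
def nu : Measure ℝ := ∑ j, (D.J : ℝ≥0∞)⁻¹ • Measure.dirac (D.x j)

/-- The functions `g[u_k]` lie in `L²(X × S)` and are uniformly bounded on `X × S`. -/
def UniformlyBounded : Prop :=
  (∀ k, MemLp (fun p : ℝ × I => D.g (D.u k) p.1 p.2) 2 (D.nu.prod volume)) ∧
  ∃ C : ℝ, ∀ k j s, |D.g (D.u k) (D.x j) s| ≤ C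

/-- The forward operator `R_φ[v](x) = ∫_S φ(s) g[v](x,s) ds`. -/
def R (φ : I → ℝ) (v : 𝕏) (x : ℝ) : ℝ := ∫ s : I, φ s * D.g v x s

/-- The normalization constant of the exploration measure. -/
def Z : ℝ := (1 / (D.n₀ : ℝ)) * ∑ k, ∫ s : I, ∫ x, |D.g (D.u k) x s| ∂D.nu

/-- The density of the exploration measure. -/
def rhoDot (s : I) : ℝ := (1 / (D.n₀ * D.Z)) * ∑ k, ∫ x, |D.g (D.u k) x s| ∂D.nu

/-- The exploration measure `ρ(ds) = ρ̇(s) ds` on `S`. -/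
def rho : Measure I := volume.withDensity fun s => ENNReal.ofReal (D.rhoDot s)

/-- `G(s,s') = (1/n₀) ∑_k ∫_X g[u_k](x,s) g[u_k](x,s') ν(dx)`. -/
def G (s s' : I) : ℝ := (1 / (D.n₀ : ℝ)) * ∑ k, ∫ x, D.g (D.u k) x s * D.g (D.u k) x s' ∂D.nu

open Classical in
/-- The automatic reproducing kernel. -/
def Gbar (s s' : I) : ℝ :=
  if 0 < D.rhoDot s * D.rhoDot s' then D.G s s' / (D.rhoDot s * D.rhoDot s') else 0

/-- The integral operator of the automatic kernel on functions. -/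
def integralOp (φ : I → ℝ) (s : I) : ℝ := ∫ s', φ s' * D.Gbar s s' ∂D.rho

/-- The empirical loss function for output data `f_1, …, f_{n₀}` (with `Δx = 1/J`). -/
def loss (f : Fin D.n₀ → ℝ → ℝ) (φ : I → ℝ) : ℝ :=
  (1 / (D.n₀ : ℝ)) * ∑ k, ∑ j, |D.R φ (D.u k) (D.x j) - f k (D.x j)| ^ 2 * (1 / (D.J : ℝ))

/-- The space `L²_ρ(S)`. -/
abbrev L2rho := Lp ℝ 2 D.rho

end Observation

section Operators

variable {E : Type*} [NormedAddCommGroup E] [InnerProductSpace ℝ E]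

open Classical in
/-- The inverse of a bounded operator `T` as a map from its range onto `N(T)^⊥`: for `φ` in the
range, `pinv T φ` is the unique `a ∈ N(T)^⊥` with `T a = φ` (and `0` outside of the range). -/
def pinv (T : E →L[ℝ] E) (φ : E) : E :=
  if h : ∃ a ∈ (LinearMap.ker T.toLinearMap)ᗮ, T a = φ then h.choose else 0

/-- For `T = L^{1/2}`, the inner product `⟨L^{-1/2} φ, L^{-1/2} φ'⟩` of the space `L^{1/2}(E)`. -/
def rangeInner (T : E →L[ℝ] E) (φ φ' : E) : ℝ := inner ℝ (pinv T φ) (pinv T φ')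

end Operators

/-- The Hilbert space `F` of functions on `S` is the reproducing kernel Hilbert space of `K`:
its reproducing kernel is `K`. -/
def IsRKHSOf (F : Type*) [NormedAddCommGroup F] [InnerProductSpace ℝ F] [CompleteSpace F]
    [RKHS ℝ F I ℝ] (K : I → I → ℝ) : Prop :=
  ∀ s s' : I, RKHS.kernel F s s' 1 = K s s'

end KernelLearning

end

/-! The density `rhoDot` is, up to a constant, the sum of all `|g[u_k](x_j, s)|`, so it dominates
each of them and the ratios g/ρ̇ are bounded. Scaled by `1/√(n₀J)`, they form a bounded feature map
Φ from S to a Euclidean space of dimension `n₀J`, and `Gbar s s' = ⟨Φ s, Φ s'⟩`. Let A send φ to the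
scaled values of `R_φ[u_k](x_j)`. Its adjoint sends c to the class of `s ↦ ⟨Φ s, c⟩`. Then `L =
A*A`, and the loss is `‖Aφ - y‖²` for the scaled outputs y. Compactness, positivity and (b) follow
because A has finite rank and N(A*A) = N(A). For (c), the RKHS is V = span Φ(S), with c acting as
`⟨Φ(·), c⟩`, and passing to ρ-classes is A* restricted to V. Since ran A ⊆ V and A* kills the
complement of ran A, the image is ran A* = ran `L^{1/2}`, and the representative of least norm lies
in ran A. For continuous data A* is injective on V, hence V = ran A and the class map is isometric.
-/

noncomputable section

namespace KernelLearning

/-! ### Operators on Hilbert space: pseudo-inverse, eigenbases, square roots -/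

section Operators

open ContinuousLinearMap Module.End
open scoped InnerProduct

variable {E : Type*} [NormedAddCommGroup E] [InnerProductSpace ℝ E]

/-- Two preimages in `N(T)^⊥` differ by a vector of N(T) that is orthogonal to itself, so the chosen
preimage is `a`. -/
theorem pinv_apply_of_mem {T : E →L[ℝ] E} {a : E} (ha : a ∈ (LinearMap.ker T.toLinearMap)ᗮ) :
    pinv T (T a) = a := by
  have h : ∃ a' ∈ (LinearMap.ker T.toLinearMap)ᗮ, T a' = T a := ⟨a, ha, rfl⟩
  have hp : pinv T (T a) = h.choose := dif_pos h
  have h1 := h.choose_spec.1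
  have h2 := h.choose_spec.2
  rw [hp, ← sub_eq_zero, ← inner_self_eq_zero (𝕜 := ℝ)]
  have hk : h.choose - a ∈ LinearMap.ker T.toLinearMap := by
    rw [LinearMap.mem_ker, map_sub, sub_eq_zero]
    exact h2
  exact Submodule.inner_right_of_mem_orthogonal hk (Submodule.sub_mem _ h1 ha)

theorem eq_zero_of_forall_inner_eq_zero {ι : Type*} (b : HilbertBasis ι ℝ E) {x : E}
    (h : ∀ i, inner ℝ (b i) x = 0) : x = 0 := by
  apply b.repr.injective
  ext i
  rw [b.repr_apply_apply, h, map_zero]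
  rfl

/-- For an orthonormal eigenbasis of a symmetric operator without negative eigenvalues, the
eigenvectors with positive eigenvalue span a dense subspace of `N(L)^⊥`. -/
theorem closure_span_pos_eigenvectors [CompleteSpace E] {L : E →L[ℝ] E}
    (hL : L.IsPositive) {ι : Type*} (ψ : HilbertBasis ι ℝ E) (ev : ι → ℝ)
    (h : ∀ i, L (ψ i) = ev i • ψ i) :
    (Submodule.span ℝ {φ | ∃ i, 0 < ev i ∧ φ = ψ i}).topologicalClosure =
      (LinearMap.ker L.toLinearMap)ᗮ := by
  have hnn (i : ι) : 0 ≤ ev i := by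
    have h1 := hL.inner_nonneg_left (ψ i)
    rwa [h, inner_smul_left, real_inner_self_eq_norm_sq, ψ.orthonormal.1 i, one_pow, mul_one] at h1
  -- The closure is the double complement, so it suffices that the complement of the span is N(L).
  rw [← Submodule.orthogonal_orthogonal_eq_closure]
  congr 1
  ext x
  rw [LinearMap.mem_ker, Submodule.mem_orthogonal]
  constructor
  · intro hx
    refine eq_zero_of_forall_inner_eq_zero ψ fun i => ?_
    rw [coe_coe, ← hL.inner_left_eq_inner_right, h, inner_smul_left]
    rcases (hnn i).eq_or_lt with h0 | h0
    · simp [← h0]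
    · rw [hx _ (Submodule.subset_span ⟨i, h0, rfl⟩), mul_zero]
  · intro hx u hu
    induction hu using Submodule.span_induction with
    | mem u hu =>
      obtain ⟨i, hi, rfl⟩ := hu
      have h1 : ev i * inner ℝ (ψ i) x = 0 := by
        rw [← real_inner_smul_left, ← h, hL.inner_left_eq_inner_right]
        exact (congrArg _ hx).trans (inner_zero_right _)
      exact (mul_eq_zero.mp h1).resolve_left hi.ne'
    | zero => exact inner_zero_left _
    | add u v _ _ hu hv => rw [inner_add_left, hu, hv, add_zero]
    | smul c u _ hu => rw [inner_smul_left, hu, mul_zero]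

/-- Orthonormal vectors are √2 apart, so balls of radius 1/2 around them are disjoint open sets. -/
theorem countable_of_orthonormal [TopologicalSpace.SeparableSpace E] {ι : Type*} {v : ι → E}
    (hv : Orthonormal ℝ v) : Countable ι := by
  refine Pairwise.countable_of_isOpen_disjoint (s := fun i => Metric.ball (v i) (1 / 2)) ?_
    (fun _ => Metric.isOpen_ball) fun i => ⟨v i, Metric.mem_ball_self (by norm_num)⟩
  intro i j hij
  refine Metric.ball_disjoint_ball ?_
  rw [dist_eq_norm]
  have h1 : ‖v i - v j‖ ^ 2 = 2 := by
    rw [norm_sub_sq_real, hv.1, hv.1, hv.2 hij]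
    norm_num
  nlinarith [norm_nonneg (v i - v j)]

/-- A compact symmetric operator on a separable Hilbert space has a countable complete orthonormal
basis of eigenvectors. -/
theorem exists_eigenbasis {E : Type} [NormedAddCommGroup E] [InnerProductSpace ℝ E]
    [CompleteSpace E] [TopologicalSpace.SeparableSpace E] {L : E →L[ℝ] E}
    (hc : IsCompactOperator L) (hs : L.IsSymmetric) :
    ∃ (ι : Type) (_ : Countable ι) (ψ : HilbertBasis ι ℝ E) (ev : ι → ℝ),
      ∀ i, L (ψ i) = ev i • ψ i := by
  have hcl (μ : ℝ) : IsClosed (eigenspace L.toLinearMap μ : Set E) := by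
    have : (eigenspace L.toLinearMap μ : Set E) = {x | L x = μ • x} := by
      ext x; exact mem_eigenspace_iff
    rw [this]
    exact isClosed_eq L.continuous (continuous_const_smul μ)
  have hcs (μ : ℝ) : CompleteSpace (eigenspace L.toLinearMap μ) := (hcl μ).completeSpace_coe
  choose w b hb using fun μ : ℝ => exists_hilbertBasis ℝ (eigenspace L.toLinearMap μ)
  -- Bases of the eigenspaces are glued over all real μ. The value 0 is included, so the kernel is
  -- covered too.
  have hon : Orthonormal ℝ (fun a : Σ μ, w μ => ((b a.1 a.2 : eigenspace L.toLinearMap a.1) : E)) :=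
    hs.orthogonalFamily_eigenspaces.orthonormal_sigma_orthonormal fun μ => (b μ).orthonormal
  have hbot : (Submodule.span ℝ (Set.range
      fun a : Σ μ, w μ => ((b a.1 a.2 : eigenspace L.toLinearMap a.1) : E)))ᗮ = ⊥ := by
    rw [eq_bot_iff, ← orthogonalComplement_iSup_eigenspaces_eq_bot hc hs,
      ← Submodule.iInf_orthogonal]
    refine le_iInf fun μ x hx => ?_
    have hz : (eigenspace L.toLinearMap μ).orthogonalProjectionOnto x = 0 :=
      eq_zero_of_forall_inner_eq_zero (b μ) fun i => by
        rw [Submodule.inner_orthogonalProjectionOnto_eq_of_mem_left]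
        exact hx _ (Submodule.subset_span ⟨⟨μ, i⟩, rfl⟩)
    exact Submodule.orthogonalProjectionOnto_eq_zero_iff.mp hz
  refine ⟨_, countable_of_orthonormal hon, HilbertBasis.mkOfOrthogonalEqBot hon hbot,
    fun a => a.1, fun a => ?_⟩
  rw [HilbertBasis.coe_mkOfOrthogonalEqBot]
  exact mem_eigenspace_iff.mp (b a.1 a.2).2

variable [CompleteSpace E] {K : Type*} [NormedAddCommGroup K] [InnerProductSpace ℝ K]
  [FiniteDimensional ℝ K]

theorem isCompactOperator_adjoint_comp_self (A : E →L[ℝ] K) :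
    IsCompactOperator (A.adjoint ∘L A) :=
  (isCompactOperator_of_locallyCompactSpace_dom A).clm_comp A.adjoint

/-- The positive square root of `A.adjoint A` for an operator `A` of finite rank. -/
theorem exists_isPositive_comp_self_eq (A : E →L[ℝ] K) :
    ∃ T : E →L[ℝ] E, T.IsPositive ∧ T ∘L T = A.adjoint ∘L A := by
  -- Diagonalise AA* on the finite-dimensional side: for eigenvectors `v i` the vectors A*v_i are
  -- orthogonal with squared norm `m i`. Weighting their rank-one operators by `1/√(m i)` gives the
  -- root.
  have hS : (A ∘L A.adjoint).toLinearMap.IsSymmetric := (isPositive_self_comp_adjoint A).isSymmetric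
  set v := hS.eigenvectorBasis rfl
  set m := hS.eigenvalues rfl
  have hv (i) : A (A.adjoint (v i)) = m i • v i := hS.apply_eigenvectorBasis rfl i
  have huu (i j) : inner ℝ (A.adjoint (v i)) (A.adjoint (v j)) = if i = j then m i else 0 := by
    rw [adjoint_inner_right, hv, inner_smul_left, v.inner_eq_ite]
    simp
  have hm (i) : 0 ≤ m i := by
    have := huu i i
    rw [if_pos rfl] at this
    exact this ▸ real_inner_self_nonneg
  have hu0 (i) (hi : m i = 0) : A.adjoint (v i) = 0 := by
    rw [← inner_self_eq_zero (𝕜 := ℝ), huu, if_pos rfl, hi]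
  have happ (x : E) : (∑ i, (√(m i))⁻¹ • InnerProductSpace.rankOne ℝ (A.adjoint (v i)) (A.adjoint (v i)) : E →L[ℝ] E) x
      = ∑ i, ((√(m i))⁻¹ * inner ℝ (A.adjoint (v i)) x) • A.adjoint (v i) := by
    simp [smul_smul]
  refine ⟨∑ i, (√(m i))⁻¹ • InnerProductSpace.rankOne ℝ (A.adjoint (v i)) (A.adjoint (v i)), ?_, ?_⟩
  · refine isPositive_sum _ fun i _ => IsPositive.smul_of_nonneg ?_ (by positivity)
    exact InnerProductSpace.isPositive_rankOne_self _
  · ext x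
    have hx : A.adjoint (A x) = ∑ i, inner ℝ (A.adjoint (v i)) x • A.adjoint (v i) := by
      conv_lhs => rw [← v.sum_repr' (A x)]
      simp [map_sum, adjoint_inner_left]
    rw [comp_apply, comp_apply, happ, hx]
    refine Finset.sum_congr rfl fun i _ => ?_
    rw [happ, inner_sum]
    simp only [inner_smul_right, huu, mul_ite, mul_zero, Finset.sum_ite_eq, Finset.mem_univ, if_true]
    -- For `m i = 0` the weight is the default value 0, harmless because A*v_i = 0.
    rcases (hm i).eq_or_lt with h0 | h0
    · rw [hu0 i h0.symm, smul_zero, smul_zero]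
    · congr 1
      have := And.intro (Real.mul_self_sqrt h0.le) (Real.sqrt_pos.mpr h0).ne'
      field_simp
      rw [sq, this.1, mul_comm]

/-! ### The range of the square root and its inner product -/

section SquareRoot

variable {T : E →L[ℝ] E}

theorem ker_eq_ker_comp_self (hT : T.IsPositive) :
    LinearMap.ker T.toLinearMap = LinearMap.ker (T ∘L T).toLinearMap := by
  have := ker_adjoint_comp_self T
  rw [hT.isSelfAdjoint.adjoint_eq] at this
  exact this.symm

theorem closure_range_eq (hT : T.IsPositive) :
    (LinearMap.range T.toLinearMap).topologicalClosure = (LinearMap.ker T.toLinearMap)ᗮ := by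
  have := orthogonal_ker T
  rw [hT.isSelfAdjoint.adjoint_eq] at this
  exact this.symm

theorem range_le_orthogonal_ker (hT : T.IsPositive) :
    LinearMap.range T.toLinearMap ≤ (LinearMap.ker T.toLinearMap)ᗮ :=
  closure_range_eq hT ▸ Submodule.le_topologicalClosure _

theorem rangeInner_comp_self (hT : T.IsPositive) {φ : E} (hφ : φ ∈ LinearMap.range T.toLinearMap)
    (ψ : E) : rangeInner T φ (T (T ψ)) = inner ℝ φ ψ := by
  obtain ⟨a, rfl⟩ := hφ
  -- The preimage is replaced by its projection to `N(T)^⊥`, where `pinv` recovers it. The claim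
  -- becomes ⟨a', Tψ⟩ = ⟨Ta', ψ⟩.
  set a' := (LinearMap.ker T.toLinearMap)ᗮ.starProjection a
  have haa : T a = T a' := by
    rw [← sub_eq_zero, ← map_sub]
    have := Submodule.sub_starProjection_mem_orthogonal (K := (LinearMap.ker T.toLinearMap)ᗮ) a
    rw [Submodule.orthogonal_orthogonal] at this
    exact this
  rw [coe_coe, haa, rangeInner, pinv_apply_of_mem (Submodule.starProjection_apply_mem _ _),
    pinv_apply_of_mem (a := T ψ) (range_le_orthogonal_ker hT ⟨ψ, rfl⟩), hT.inner_left_eq_inner_right]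

variable {A : E →L[ℝ] K}

theorem ker_eq_ker (hT : T.IsPositive) (h : T ∘L T = A.adjoint ∘L A) :
    LinearMap.ker T.toLinearMap = LinearMap.ker A.toLinearMap := by
  rw [ker_eq_ker_comp_self hT, h]
  exact ker_adjoint_comp_self A

/-- The finite-dimensional range of A has an orthogonal complement, which is N(A*). Only the
component of c in ran A survives under A*. -/
theorem exists_adjoint_apply_self (A : E →L[ℝ] K) (c : K) :
    ∃ a : E, A.adjoint (A a) = A.adjoint c := by
  obtain ⟨y, hy, z, hz, rfl⟩ := (LinearMap.range A.toLinearMap).exists_add_mem_mem_orthogonal c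
  obtain ⟨a, rfl⟩ := hy
  rw [orthogonal_range] at hz
  refine ⟨a, ?_⟩
  have hz' : A.adjoint z = 0 := hz
  simp [hz']

theorem range_eq_range_adjoint (hT : T.IsPositive) (h : T ∘L T = A.adjoint ∘L A) :
    LinearMap.range T.toLinearMap = LinearMap.range A.adjoint.toLinearMap := by
  apply le_antisymm
  · refine (range_le_orthogonal_ker hT).trans ?_
    -- Finite rank makes ran A* closed, so it is all of `N(A)^⊥`.
    rw [ker_eq_ker hT h, orthogonal_ker, IsClosed.submodule_topologicalClosure_eq]
    exact Submodule.closed_of_finiteDimensional _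
  · rintro _ ⟨c, rfl⟩
    obtain ⟨a, ha⟩ := exists_adjoint_apply_self A c
    exact ⟨T a, (congrArg (fun S : E →L[ℝ] E => S a) h).trans ha⟩

theorem rangeInner_adjoint_apply (hT : T.IsPositive) (h : T ∘L T = A.adjoint ∘L A) (a a' : E) :
    rangeInner T (A.adjoint (A a)) (A.adjoint (A a')) = inner ℝ (A a) (A a') := by
  have h1 (x : E) : T (T x) = A.adjoint (A x) := congrArg (fun S : E →L[ℝ] E => S x) h
  rw [← h1 a, ← h1 a', rangeInner_comp_self hT (φ := T (T a)) ⟨T a, rfl⟩, h1, adjoint_inner_left]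

end SquareRoot

end Operators

/-! ### Reproducing kernel spaces of finite-dimensional feature maps -/

section FeatureMap

variable {X : Type*} {K : Type*} [NormedAddCommGroup K] [InnerProductSpace ℝ K]

/-- The reproducing kernel Hilbert space with feature map `Φ : X → K`: the span of the features,
with `c` acting as the function `x ↦ ⟨Φ x, c⟩`. -/
abbrev featureRKHS (Φ : X → K) :
    RKHS ℝ (Submodule.span ℝ (Set.range Φ)) X ℝ where
  coeCLM := ContinuousLinearMap.pi fun x =>
    (innerSL ℝ (Φ x)) ∘L (Submodule.span ℝ (Set.range Φ)).subtypeL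
  coeCLM_injective := by
    refine (injective_iff_map_eq_zero _).mpr fun c hc => ?_
    -- A vector acting as the zero function is orthogonal to every feature, hence to their span,
    -- which contains it.
    have h : ∀ v ∈ Submodule.span ℝ (Set.range Φ), inner ℝ v (c : K) = 0 := fun v hv => by
      induction hv using Submodule.span_induction with
      | mem v hv => obtain ⟨x, rfl⟩ := hv; exact congrFun hc x
      | zero => exact inner_zero_left _
      | add u v _ _ hu hv => rw [inner_add_left, hu, hv, add_zero]
      | smul r u _ hu => rw [inner_smul_left, hu, mul_zero]
    exact Subtype.ext (inner_self_eq_zero.mp (h c c.2))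

theorem kernel_featureRKHS [FiniteDimensional ℝ K] (Φ : X → K) (x y : X) :
    letI := featureRKHS Φ
    RKHS.kernel (Submodule.span ℝ (Set.range Φ)) x y 1 = inner ℝ (Φ x) (Φ y) := by
  let := featureRKHS Φ
  have h : RKHS.kerFun (Submodule.span ℝ (Set.range Φ)) y (1 : ℝ) =
      ⟨Φ y, Submodule.subset_span ⟨y, rfl⟩⟩ := by
    refine ext_inner_right ℝ fun c => ?_
    rw [RKHS.kerFun_inner]
    exact mul_one _
  rw [← RKHS.kerFun_apply, h]
  rfl

variable {F : Type*} [NormedAddCommGroup F] [InnerProductSpace ℝ F] [CompleteSpace F] [RKHS ℝ F X ℝ]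

/-- A reproducing kernel Hilbert space whose kernel is given by a feature map into a
finite-dimensional space is isometric to the span of the features. -/
theorem exists_isometry_of_kernel_eq [FiniteDimensional ℝ K] {Φ : X → K}
    (hK : ∀ x y, RKHS.kernel F x y 1 = inner ℝ (Φ x) (Φ y)) :
    ∃ U : F ≃ₗᵢ[ℝ] Submodule.span ℝ (Set.range Φ), ∀ (h : F) (x : X),
      h x = inner ℝ (Φ x) (U h : K) := by
  set k : X → F := fun x => RKHS.kerFun F x 1
  have hk (x : X) (h : F) : inner ℝ (k x) h = h x := by
    rw [RKHS.kerFun_inner]; exact mul_one _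
  have hkk (x y : X) : inner ℝ (k x) (k y) = inner ℝ (Φ x) (Φ y) := by
    rw [hk, RKHS.kerFun_apply, hK]
  set α := Finsupp.linearCombination ℝ Φ
  set β := Finsupp.linearCombination ℝ k
  -- The features and the kernel sections have the same Gram matrix, so their linear combinations
  -- satisfy the same relations; `e` matches them.
  have hαβ (a a' : X →₀ ℝ) : inner ℝ (α a) (α a') = inner ℝ (β a) (β a') := by
    simp only [α, β, Finsupp.linearCombination_apply, Finsupp.sum_inner, Finsupp.inner_sum,
      inner_smul_left, inner_smul_right, hkk]
  have hker : LinearMap.ker α = LinearMap.ker β := by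
    ext a
    rw [LinearMap.mem_ker, LinearMap.mem_ker, ← inner_self_eq_zero (𝕜 := ℝ), hαβ,
      inner_self_eq_zero]
  have hα : LinearMap.range α = Submodule.span ℝ (Set.range Φ) := Finsupp.range_linearCombination ℝ
  let e : LinearMap.range β ≃ₗ[ℝ] LinearMap.range α :=
    β.quotKerEquivRange.symm ≪≫ₗ Submodule.quotEquivOfEq _ _ hker.symm ≪≫ₗ α.quotKerEquivRange
  have he (a : X →₀ ℝ) : (e ⟨β a, a, rfl⟩ : K) = α a := by
    have : (⟨β a, a, rfl⟩ : LinearMap.range β) =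
      β.quotKerEquivRange (Submodule.Quotient.mk a) := rfl
    rw [this]
    simp only [e, LinearEquiv.trans_apply, LinearEquiv.symm_apply_apply]
    rfl
  have : FiniteDimensional ℝ (LinearMap.range β) := LinearEquiv.finiteDimensional e.symm
  -- The kernel sections span a dense subspace; being finite-dimensional it is closed, hence all of
  -- F.
  have hβ : LinearMap.range β = ⊤ := by
    have hcl := (Submodule.closed_of_finiteDimensional (LinearMap.range β))
    rw [eq_top_iff, ← RKHS.kerFun_dense (H := F) (X := X) (V := ℝ) (𝕜 := ℝ)]
    refine Submodule.topologicalClosure_minimal _ (Submodule.span_le.mpr ?_) hcl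
    rintro _ ⟨x, v, rfl⟩
    refine ⟨Finsupp.single x v, ?_⟩
    rw [Finsupp.linearCombination_single, ← map_smul, smul_eq_mul, mul_one]
  let e' : F ≃ₗ[ℝ] Submodule.span ℝ (Set.range Φ) :=
    (LinearEquiv.ofTop _ hβ).symm ≪≫ₗ e ≪≫ₗ LinearEquiv.ofEq _ _ hα
  have he' (a : X →₀ ℝ) : (e' (β a) : K) = α a := he a
  have hsurj (h : F) : ∃ a, β a = h := LinearMap.range_eq_top.mp hβ h
  refine ⟨e'.isometryOfInner fun h h' => ?_, fun h x => ?_⟩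
  · obtain ⟨a, rfl⟩ := hsurj h
    obtain ⟨a', rfl⟩ := hsurj h'
    rw [Submodule.coe_inner, he', he', hαβ]
  · obtain ⟨a, rfl⟩ := hsurj h
    have h1 := hαβ (Finsupp.single x 1) a
    rw [Finsupp.linearCombination_single, Finsupp.linearCombination_single, one_smul, one_smul,
      hk] at h1
    rw [← h1]
    exact congrArg _ (he' a).symm

end FeatureMap

/-- Every nonempty relatively open set meets (0,1). This lets continuous functions that agree almost
everywhere be identified. -/
instance isOpenPosMeasure_unitInterval : (volume : Measure I).IsOpenPosMeasure where
  open_pos U hU hne := by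
    obtain ⟨V, hV, rfl⟩ := isOpen_induced_iff.mp hU
    obtain ⟨⟨x, hx⟩, hxV⟩ := hne
    have hx' : x ∈ closure (Set.Ioo (0 : ℝ) 1) := by rwa [closure_Ioo zero_ne_one]
    have hne : (V ∩ Set.Ioo (0 : ℝ) 1).Nonempty := mem_closure_iff.mp hx' V hV hxV
    have hpos := (hV.inter isOpen_Ioo).measure_pos volume hne
    have hsub : V ∩ Set.Ioo (0 : ℝ) 1 ⊆ (Subtype.val '' (Subtype.val ⁻¹' V : Set I) : Set ℝ) :=
      fun y hy => ⟨⟨y, Set.Ioo_subset_Icc_self hy.2⟩, hy.1, rfl⟩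
    have hcomap : (volume : Measure I) (Subtype.val ⁻¹' V) =
        volume (Subtype.val '' (Subtype.val ⁻¹' V : Set I) : Set ℝ) :=
      comap_subtype_coe_apply measurableSet_Icc volume _
    rw [hcomap]
    exact (hpos.trans_le (measure_mono hsub)).ne'

theorem coeFn_sum_Lp {α ι : Type*} [MeasurableSpace α] {μ : Measure α} {p : ℝ≥0∞}
    (t : Finset ι) (f : ι → Lp ℝ p μ) :
    ⇑(∑ i ∈ t, f i) =ᵐ[μ] fun a => ∑ i ∈ t, f i a := by
  classical
  induction t using Finset.induction_on with
  | empty => simpa using! Lp.coeFn_zero ℝ p μ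
  | insert i t hi h =>
    rw [Finset.sum_insert hi]
    filter_upwards [Lp.coeFn_add (f i) (∑ i ∈ t, f i), h] with a h1 h2
    rw [h1, Pi.add_apply, h2, Finset.sum_insert hi]

/-! ### The exploration measure and the feature map of the kernel -/

namespace Observation

variable {𝕏 : Type*} {D : Observation 𝕏}

theorem integral_nu (D : Observation 𝕏) (f : ℝ → ℝ) :
    ∫ x, f x ∂D.nu = (1 / (D.J : ℝ)) * ∑ j, f (D.x j) := by
  rw [nu, integral_finsetSum_measure, Finset.mul_sum]
  · refine Finset.sum_congr rfl fun j _ => ?_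
    rw [integral_smul_measure, integral_dirac]
    simp
  · intro j _
    refine Integrable.smul_measure (integrable_dirac (by simp)) ?_
    simp [Nat.pos_iff_ne_zero.mp (Fin.pos j)]

theorem n₀_pos (hZ : 0 < D.Z) : 0 < (D.n₀ : ℝ) := by
  rcases Nat.eq_zero_or_pos D.n₀ with h | h
  · simp [Z, h] at hZ
  · exact_mod_cast h

theorem J_pos (hZ : 0 < D.Z) : 0 < (D.J : ℝ) := by
  rcases Nat.eq_zero_or_pos D.J with h | h
  · simp [Z, integral_nu, h] at hZ
  · exact_mod_cast h

/-- The function `g[u_k](x_j, ·)`. -/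
def slice (D : Observation 𝕏) (i : Fin D.n₀ × Fin D.J) (s : I) : ℝ := D.g (D.u i.1) (D.x i.2) s

/-- Joint measurability gives measurable sections for ν-almost every x, and each `x_j` is an atom of
positive mass. -/
theorem aestronglyMeasurable_slice (hD : D.UniformlyBounded) (i : Fin D.n₀ × Fin D.J) :
    AEStronglyMeasurable (D.slice i) volume := by
  have h := (hD.1 i.1).1.prodMk_left
  rw [nu, ae_iff, Measure.finsetSum_apply, Finset.sum_eq_zero_iff] at h
  have h1 := h i.2 (Finset.mem_univ _)
  rw [Measure.smul_apply, smul_eq_mul, mul_eq_zero] at h1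
  rcases h1 with h1 | h1
  · simp at h1
  · have h2 := ae_iff.mpr h1
    rw [ae_dirac_eq] at h2
    exact h2

theorem rhoDot_eq (D : Observation 𝕏) (s : I) :
    D.rhoDot s = (1 / (D.n₀ * D.J * D.Z)) * ∑ i, |D.slice i s| := by
  rw [rhoDot, Fintype.sum_prod_type, Finset.mul_sum, Finset.mul_sum]
  refine Finset.sum_congr rfl fun k _ => ?_
  rw [integral_nu, ← mul_assoc, one_div_mul_one_div]
  simp only [slice]
  ring_nf

theorem rhoDot_nonneg (hZ : 0 < D.Z) (s : I) : 0 ≤ D.rhoDot s := by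
  rw [rhoDot_eq]
  positivity

theorem abs_slice_le (hZ : 0 < D.Z) (i : Fin D.n₀ × Fin D.J) (s : I) :
    |D.slice i s| ≤ (D.n₀ * D.J * D.Z) * D.rhoDot s := by
  have := n₀_pos hZ
  have := J_pos hZ
  rw [rhoDot_eq, ← mul_assoc, mul_one_div_cancel (by positivity), one_mul]
  exact Finset.single_le_sum (f := fun i => |D.slice i s|) (fun _ _ => abs_nonneg _)
    (Finset.mem_univ i)

/-- The quotient `g[u_k](x_j, s) / ρ̇(s)`. -/
def ratio (D : Observation 𝕏) (i : Fin D.n₀ × Fin D.J) (s : I) : ℝ := D.slice i s / D.rhoDot s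

/-- Where `rhoDot` vanishes so does every slice, so the convention for division by zero loses
nothing. -/
theorem rhoDot_mul_ratio (hZ : 0 < D.Z) (i : Fin D.n₀ × Fin D.J) (s : I) :
    D.rhoDot s * D.ratio i s = D.slice i s := by
  by_cases h : D.rhoDot s = 0
  · have := abs_slice_le hZ i s
    rw [h, mul_zero] at this
    rw [h, zero_mul, abs_nonpos_iff.mp this]
  · exact mul_div_cancel₀ _ h

theorem abs_ratio_le (hZ : 0 < D.Z) (i : Fin D.n₀ × Fin D.J) (s : I) :
    |D.ratio i s| ≤ D.n₀ * D.J * D.Z := by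
  rw [ratio, abs_div, abs_of_nonneg (rhoDot_nonneg hZ s)]
  exact div_le_of_le_mul₀ (rhoDot_nonneg hZ s) (by positivity) (abs_slice_le hZ i s)

theorem aestronglyMeasurable_rhoDot (hD : D.UniformlyBounded) :
    AEStronglyMeasurable D.rhoDot volume := by
  simp_rw [funext D.rhoDot_eq]
  refine AEStronglyMeasurable.const_mul ?_ _
  exact Finset.aestronglyMeasurable_fun_sum _ fun i _ => (aestronglyMeasurable_slice hD i).norm

theorem aemeasurable_ofReal_rhoDot (hD : D.UniformlyBounded) :
    AEMeasurable (fun s => ENNReal.ofReal (D.rhoDot s)) volume :=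
  (aestronglyMeasurable_rhoDot hD).aemeasurable.ennreal_ofReal

theorem isFiniteMeasure_rho (hD : D.UniformlyBounded) (hZ : 0 < D.Z) : IsFiniteMeasure D.rho := by
  obtain ⟨C, hC⟩ := hD.2
  refine isFiniteMeasure_withDensity_ofReal (Integrable.of_bound (aestronglyMeasurable_rhoDot hD)
    ((1 / (D.n₀ * D.J * D.Z)) * ∑ _i : Fin D.n₀ × Fin D.J, C) (.of_forall fun s => ?_)).2
  rw [Real.norm_of_nonneg (rhoDot_nonneg hZ s), rhoDot_eq]
  gcongr with i
  exact hC i.1 i.2 s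

theorem aestronglyMeasurable_ratio (hD : D.UniformlyBounded) (i : Fin D.n₀ × Fin D.J) :
    AEStronglyMeasurable (D.ratio i) D.rho :=
  ((aestronglyMeasurable_slice hD i).aemeasurable.div
    (aestronglyMeasurable_rhoDot hD).aemeasurable).aestronglyMeasurable.mono_ac
    (withDensity_absolutelyContinuous _ _)

theorem integral_rho (hD : D.UniformlyBounded) (hZ : 0 < D.Z) (φ : I → ℝ) :
    ∫ s, φ s ∂D.rho = ∫ s, D.rhoDot s * φ s := by
  rw [rho, integral_withDensity_eq_integral_toReal_smul₀ (aemeasurable_ofReal_rhoDot hD)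
    (.of_forall fun _ => ENNReal.ofReal_lt_top)]
  simp only [ENNReal.toReal_ofReal (rhoDot_nonneg hZ _), smul_eq_mul]

theorem integrable_rho_iff (hD : D.UniformlyBounded) (hZ : 0 < D.Z) (φ : I → ℝ) :
    Integrable φ D.rho ↔ Integrable (fun s => D.rhoDot s * φ s) volume := by
  rw [rho, integrable_withDensity_iff_integrable_smul₀' (aemeasurable_ofReal_rhoDot hD)
    (.of_forall fun _ => ENNReal.ofReal_lt_top)]
  simp only [ENNReal.toReal_ofReal (rhoDot_nonneg hZ _), smul_eq_mul]

theorem R_eq_integral (hD : D.UniformlyBounded) (hZ : 0 < D.Z) (φ : I → ℝ)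
    (i : Fin D.n₀ × Fin D.J) :
    D.R φ (D.u i.1) (D.x i.2) = ∫ s, φ s * D.ratio i s ∂D.rho := by
  rw [integral_rho hD hZ]
  refine integral_congr_ae (.of_forall fun s => ?_)
  dsimp only
  rw [mul_left_comm, rhoDot_mul_ratio hZ]
  rfl

theorem memLp_ratio (hD : D.UniformlyBounded) (hZ : 0 < D.Z) (i : Fin D.n₀ × Fin D.J)
    (p : ℝ≥0∞) : MemLp (D.ratio i) p D.rho := by
  have := isFiniteMeasure_rho hD hZ
  exact MemLp.of_bound (aestronglyMeasurable_ratio hD i) _ (.of_forall (abs_ratio_le hZ i))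

theorem integrable_mul_ratio (hD : D.UniformlyBounded) (hZ : 0 < D.Z) {φ : I → ℝ}
    (hφ : MemLp φ 2 D.rho) (i : Fin D.n₀ × Fin D.J) :
    Integrable (fun s => φ s * D.ratio i s) D.rho :=
  hφ.integrable_mul (memLp_ratio hD hZ i 2)

theorem integrable_mul_slice (hD : D.UniformlyBounded) (hZ : 0 < D.Z) {φ : I → ℝ}
    (hφ : MemLp φ 2 D.rho) (i : Fin D.n₀ × Fin D.J) :
    Integrable (fun s => φ s * D.slice i s) volume := by
  refine ((integrable_rho_iff hD hZ _).mp (integrable_mul_ratio hD hZ hφ i)).congr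
    (.of_forall fun s => ?_)
  dsimp only
  rw [mul_left_comm, rhoDot_mul_ratio hZ]

/-- The weight `1 / √(n₀ J)`. -/
def weight (D : Observation 𝕏) : ℝ := √(1 / (D.n₀ * D.J))

theorem weight_mul_self (D : Observation 𝕏) : D.weight * D.weight = 1 / D.n₀ * (1 / D.J) := by
  rw [weight, Real.mul_self_sqrt (by positivity), one_div_mul_one_div]

/-- The feature map `s ↦ (g[u_k](x_j, s) / (ρ̇(s) √(n₀ J)))_{k,j}` of the kernel `Gbar`. -/
def feature (D : Observation 𝕏) (s : I) : EuclideanSpace ℝ (Fin D.n₀ × Fin D.J) :=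
  WithLp.toLp 2 fun i => D.weight * D.ratio i s

theorem feature_inner (s : I) (c : EuclideanSpace ℝ (Fin D.n₀ × Fin D.J)) :
    inner ℝ (D.feature s) c = ∑ i, c i * (D.weight * D.ratio i s) := by
  simp [PiLp.inner_apply, feature]

theorem Gbar_eq (hZ : 0 < D.Z) (s s' : I) : D.Gbar s s' = inner ℝ (D.feature s) (D.feature s') := by
  have hG : D.G s s' = D.weight * D.weight * ∑ i, D.slice i s * D.slice i s' := by
    rw [weight_mul_self, G, Fintype.sum_prod_type, mul_assoc, Finset.mul_sum]
    simp only [integral_nu, slice, Finset.mul_sum]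
  have h (i) : (D.feature s' i) * (D.weight * D.ratio i s) =
      D.weight * D.weight * (D.slice i s * D.slice i s') / (D.rhoDot s * D.rhoDot s') := by
    simp only [feature, ratio]
    ring
  rw [feature_inner, Finset.sum_congr rfl fun i _ => h i, ← Finset.sum_div, ← Finset.mul_sum, ← hG,
    Gbar]
  split_ifs with h0
  · rfl
  · have : D.rhoDot s * D.rhoDot s' = 0 :=
      le_antisymm (not_lt.mp h0) (mul_nonneg (rhoDot_nonneg hZ s) (rhoDot_nonneg hZ s'))
    rw [this, div_zero]

theorem Gbar_eq_sum (hZ : 0 < D.Z) (s s' : I) :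
    D.Gbar s s' = ∑ i, (D.weight * D.ratio i s') * (D.weight * D.ratio i s) := by
  rw [Gbar_eq hZ, feature_inner]
  rfl

theorem memLp_Gbar (hD : D.UniformlyBounded) (hZ : 0 < D.Z) :
    MemLp (fun p : I × I => D.Gbar p.1 p.2) 2 (D.rho.prod D.rho) := by
  have := isFiniteMeasure_rho hD hZ
  simp_rw [Gbar_eq_sum hZ]
  refine memLp_finsetSum _ fun i _ => ?_
  refine MemLp.of_bound (C := (D.weight * (D.n₀ * D.J * D.Z)) * (D.weight * (D.n₀ * D.J * D.Z)))
    ?_ (.of_forall fun p => ?_)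
  · exact ((aestronglyMeasurable_ratio hD i).comp_snd.const_mul _).mul
      ((aestronglyMeasurable_ratio hD i).comp_fst.const_mul _)
  · have hw : 0 ≤ D.weight := Real.sqrt_nonneg _
    rw [norm_mul, norm_mul, norm_mul, Real.norm_of_nonneg hw]
    gcongr
    · exact abs_ratio_le hZ i _
    · exact abs_ratio_le hZ i _

theorem integrable_mul_Gbar (hD : D.UniformlyBounded) (hZ : 0 < D.Z) {φ : I → ℝ}
    (hφ : MemLp φ 2 D.rho) (s : I) : Integrable (fun s' => φ s' * D.Gbar s s') D.rho := by
  simp_rw [Gbar_eq_sum hZ, Finset.mul_sum]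
  refine integrable_finsetSum _ fun i _ => ?_
  refine ((integrable_mul_ratio hD hZ hφ i).const_mul (D.weight * (D.weight * D.ratio i s))).congr
    (.of_forall fun s' => ?_)
  dsimp only
  ring

theorem integralOp_eq (hD : D.UniformlyBounded) (hZ : 0 < D.Z) {φ : I → ℝ}
    (hφ : MemLp φ 2 D.rho) (s : I) : D.integralOp φ s =
      ∑ i, (D.weight * D.R φ (D.u i.1) (D.x i.2)) * (D.weight * D.ratio i s) := by
  simp_rw [integralOp, Gbar_eq_sum hZ, Finset.mul_sum]
  rw [integral_finsetSum]
  · refine Finset.sum_congr rfl fun i _ => ?_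
    rw [R_eq_integral hD hZ, mul_right_comm, ← integral_const_mul]
    refine integral_congr_ae (.of_forall fun s' => ?_)
    dsimp only
    ring
  · intro i _
    refine ((integrable_mul_ratio hD hZ hφ i).const_mul (D.weight * (D.weight * D.ratio i s))).congr
      (.of_forall fun s' => ?_)
    dsimp only
    ring

/-! ### The finite-rank factorization of the integral operator and the loss -/

section AnalysisOperator

open ContinuousLinearMap

/-- The classes in `L²_ρ` of the components of the feature map. -/
def featureLp (hD : D.UniformlyBounded) (hZ : 0 < D.Z) (i : Fin D.n₀ × Fin D.J) : D.L2rho :=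
  ((memLp_ratio hD hZ i 2).const_mul D.weight).toLp _

/-- The operator `φ ↦ (R_φ[u_k](x_j) / √(n₀ J))_{k,j}`. -/
def analysis (hD : D.UniformlyBounded) (hZ : 0 < D.Z) :
    D.L2rho →L[ℝ] EuclideanSpace ℝ (Fin D.n₀ × Fin D.J) :=
  (EuclideanSpace.equiv (Fin D.n₀ × Fin D.J) ℝ).symm.toContinuousLinearMap ∘L
    ContinuousLinearMap.pi fun i => innerSL ℝ (featureLp hD hZ i)

variable (hD : D.UniformlyBounded) (hZ : 0 < D.Z)

theorem analysis_apply (φ : D.L2rho) (i : Fin D.n₀ × Fin D.J) :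
    analysis hD hZ φ i = D.weight * D.R φ (D.u i.1) (D.x i.2) := by
  have h : analysis hD hZ φ i = inner ℝ (featureLp hD hZ i) φ := rfl
  rw [h, R_eq_integral hD hZ, ← integral_const_mul, L2.inner_def]
  refine integral_congr_ae ?_
  filter_upwards [((memLp_ratio hD hZ i 2).const_mul D.weight).coeFn_toLp] with s hs
  rw [featureLp, hs]
  simp only [RCLike.inner_apply, conj_trivial]
  ring

theorem adjoint_analysis_apply (c : EuclideanSpace ℝ (Fin D.n₀ × Fin D.J)) :
    (analysis hD hZ).adjoint c = ∑ i, c i • featureLp hD hZ i := by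
  refine ext_inner_right ℝ fun φ => ?_
  rw [adjoint_inner_left, PiLp.inner_apply, sum_inner]
  refine Finset.sum_congr rfl fun i _ => ?_
  rw [real_inner_smul_left]
  exact mul_comm _ _

theorem coeFn_adjoint_analysis (c : EuclideanSpace ℝ (Fin D.n₀ × Fin D.J)) :
    (analysis hD hZ).adjoint c =ᵐ[D.rho] fun s => inner ℝ (D.feature s) c := by
  rw [adjoint_analysis_apply]
  have h1 : ∀ᵐ s ∂D.rho, ∀ i, (c i • featureLp hD hZ i : D.L2rho) s =
      c i * (D.weight * D.ratio i s) := by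
    refine ae_all_iff.mpr fun i => ?_
    filter_upwards [Lp.coeFn_smul (c i) (featureLp hD hZ i),
      ((memLp_ratio hD hZ i 2).const_mul D.weight).coeFn_toLp] with s h1 h2
    rw [h1, Pi.smul_apply, featureLp, h2, smul_eq_mul]
  filter_upwards [h1, coeFn_sum_Lp Finset.univ fun i => c i • featureLp hD hZ i]
    with s h1 h2
  rw [h2, feature_inner]
  exact Finset.sum_congr rfl fun i _ => h1 i

theorem coeFn_adjoint_comp_self_analysis (φ : D.L2rho) :
    ((analysis hD hZ).adjoint ∘L analysis hD hZ) φ =ᵐ[D.rho] D.integralOp φ := by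
  refine (coeFn_adjoint_analysis hD hZ _).trans (.of_forall fun s => ?_)
  dsimp only
  rw [feature_inner, integralOp_eq hD hZ (Lp.memLp φ)]
  exact Finset.sum_congr rfl fun i _ => congrArg (· * _) (analysis_apply hD hZ φ i)

/-- The outputs `f_k(x_j) / √(n₀ J)`. -/
def outputs (D : Observation 𝕏) (f : Fin D.n₀ → ℝ → ℝ) :
    EuclideanSpace ℝ (Fin D.n₀ × Fin D.J) :=
  WithLp.toLp 2 fun i => D.weight * f i.1 (D.x i.2)

theorem loss_eq (f : Fin D.n₀ → ℝ → ℝ) (φ : D.L2rho) :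
    D.loss f φ = ‖analysis hD hZ φ - D.outputs f‖ ^ 2 := by
  rw [EuclideanSpace.norm_sq_eq, Fintype.sum_prod_type, loss, Finset.mul_sum]
  refine Finset.sum_congr rfl fun k _ => ?_
  rw [Finset.mul_sum]
  refine Finset.sum_congr rfl fun j _ => ?_
  rw [PiLp.sub_apply, analysis_apply]
  simp only [outputs]
  rw [← mul_sub, norm_mul, mul_pow, Real.norm_eq_abs, Real.norm_eq_abs, sq_abs, sq |D.weight|,
    abs_mul_abs_self, weight_mul_self]
  ring

theorem inner_outputs_analysis (f : Fin D.n₀ → ℝ → ℝ) (φ : D.L2rho) :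
    inner ℝ (D.outputs f) (analysis hD hZ φ) =
      (1 / (D.n₀ : ℝ)) * ∑ k, ∫ x, D.R φ (D.u k) x * f k x ∂D.nu := by
  rw [PiLp.inner_apply, Fintype.sum_prod_type, Finset.mul_sum]
  refine Finset.sum_congr rfl fun k _ => ?_
  rw [integral_nu, ← mul_assoc, ← weight_mul_self, Finset.mul_sum]
  refine Finset.sum_congr rfl fun j _ => ?_
  rw [analysis_apply]
  simp only [outputs, RCLike.inner_apply, conj_trivial]
  ring

theorem outputs_eq_analysis {f : Fin D.n₀ → ℝ → ℝ} {φ : D.L2rho}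
    (h : ∀ k j, f k (D.x j) = D.R φ (D.u k) (D.x j)) : D.outputs f = analysis hD hZ φ := by
  ext i
  rw [analysis_apply, ← h]
  rfl

/-- If c is orthogonal to all features, then A*c, the class of `⟨Φ(·), c⟩`, is zero. Equality may
fail, since features on a ρ-null set can enlarge the span. -/
theorem range_analysis_le :
    LinearMap.range (analysis hD hZ).toLinearMap ≤ Submodule.span ℝ (Set.range D.feature) := by
  rw [← Submodule.orthogonal_le_orthogonal_iff, orthogonal_range]
  intro c hc
  refine Lp.ext ((coeFn_adjoint_analysis hD hZ c).trans ?_)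
  refine EventuallyEq.trans (.of_forall fun s => ?_) (Lp.coeFn_zero _ _ _).symm
  exact hc _ (Submodule.subset_span ⟨s, rfl⟩)

theorem feature_inner_eq_zero_of_continuous (hD : D.UniformlyBounded) (hZ : 0 < D.Z)
    (hc : ∀ k j, Continuous (D.g (D.u k) (D.x j)))
    {c : EuclideanSpace ℝ (Fin D.n₀ × Fin D.J)}
    (h : ∀ᵐ s ∂D.rho, inner ℝ (D.feature s) c = 0) (s : I) : inner ℝ (D.feature s) c = 0 := by
  have h1 (s : I) : D.rhoDot s * inner ℝ (D.feature s) c =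
      ∑ i, c i * (D.weight * D.slice i s) := by
    rw [feature_inner, Finset.mul_sum]
    refine Finset.sum_congr rfl fun i _ => ?_
    rw [← rhoDot_mul_ratio hZ]
    ring
  -- The ratios need not be continuous at zeros of `rhoDot`; multiplying by `rhoDot` restores the
  -- continuous slices. At its zeros the ratios are 0 by convention.
  have hcont : Continuous fun s => D.rhoDot s * inner ℝ (D.feature s) c := by
    simp_rw [h1]
    exact continuous_finsetSum _ fun i _ =>
      continuous_const.mul (continuous_const.mul (hc i.1 i.2))
  rw [rho, ae_withDensity_iff' (aemeasurable_ofReal_rhoDot hD)] at h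
  have h2 : (fun s => D.rhoDot s * inner ℝ (D.feature s) c) = fun _ => 0 := by
    refine (Continuous.ae_eq_iff_eq volume hcont continuous_const).mp ?_
    filter_upwards [h] with s hs
    by_cases h0 : D.rhoDot s = 0
    · rw [h0, zero_mul]
    · rw [hs (by simpa using (rhoDot_nonneg hZ s).lt_of_ne' h0), mul_zero]
  rcases mul_eq_zero.mp (congrFun h2 s) with h0 | h0
  · rw [feature_inner]
    simp [ratio, h0]
  · exact h0

end AnalysisOperator

end Observation

/-! ### Least squares and projection onto the complement of the kernel -/

section LeastSquares

open ContinuousLinearMap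

variable {E K : Type*} [NormedAddCommGroup E] [InnerProductSpace ℝ E] [CompleteSpace E]
  [NormedAddCommGroup K] [InnerProductSpace ℝ K]

theorem norm_apply_sub_sq [CompleteSpace K] (A : E →L[ℝ] K) (y : K) (φ : E) :
    ‖A φ - y‖ ^ 2 =
      inner ℝ ((A.adjoint ∘L A) φ) φ - 2 * inner ℝ (A.adjoint y) φ + ‖y‖ ^ 2 := by
  rw [norm_sub_sq_real, comp_apply, adjoint_inner_left, adjoint_inner_left,
    real_inner_self_eq_norm_sq, real_inner_comm y]

theorem apply_starProjection_orthogonal_ker (A : E →L[ℝ] K) (φ : E) :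
    A ((LinearMap.ker A.toLinearMap)ᗮ.starProjection φ) = A φ := by
  symm
  rw [← sub_eq_zero, ← map_sub]
  have h := Submodule.sub_starProjection_mem_orthogonal (K := (LinearMap.ker A.toLinearMap)ᗮ) φ
  rw [Submodule.orthogonal_orthogonal] at h
  exact h

theorem eq_starProjection_of_apply_eq (A : E →L[ℝ] K) {φ ψ : E}
    (hφ : φ ∈ (LinearMap.ker A.toLinearMap)ᗮ) (h : A φ = A ψ) :
    φ = (LinearMap.ker A.toLinearMap)ᗮ.starProjection ψ := by
  refine (Submodule.eq_starProjection_of_mem_of_inner_eq_zero hφ fun w hw => ?_).symm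
  refine Submodule.inner_right_of_mem_orthogonal (K := LinearMap.ker A.toLinearMap) ?_ hw
  rw [LinearMap.mem_ker, map_sub, sub_eq_zero]
  exact h.symm

end LeastSquares

namespace Observation

open ContinuousLinearMap

variable {𝕏 : Type*} {D : Observation 𝕏} (hD : D.UniformlyBounded) (hZ : 0 < D.Z)

theorem exists_isRKHSOf_Gbar (hZ : 0 < D.Z) :
    ∃ (F : Type) (_ : NormedAddCommGroup F) (_ : InnerProductSpace ℝ F)
      (_ : CompleteSpace F) (_ : RKHS ℝ F I ℝ), IsRKHSOf F D.Gbar :=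
  ⟨Submodule.span ℝ (Set.range D.feature), inferInstance, inferInstance, inferInstance,
    featureRKHS D.feature, fun s s' => (kernel_featureRKHS D.feature s s').trans
      (Gbar_eq hZ s s').symm⟩

/-! ### Comparison of the RKHS with the range of the square root -/

section RKHS

variable {F : Type*} [NormedAddCommGroup F] [InnerProductSpace ℝ F] [RKHS ℝ F I ℝ]

theorem exists_isometry_span_feature [CompleteSpace F] (hZ : 0 < D.Z) (hF : IsRKHSOf F D.Gbar) :
    ∃ U : F ≃ₗᵢ[ℝ] Submodule.span ℝ (Set.range D.feature), ∀ (h : F) (s : I),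
      h s = inner ℝ (D.feature s) (U h : EuclideanSpace ℝ (Fin D.n₀ × Fin D.J)) :=
  exists_isometry_of_kernel_eq fun s s' => (hF s s').trans (Gbar_eq hZ s s')

variable {U : F ≃ₗᵢ[ℝ] Submodule.span ℝ (Set.range D.feature)}

theorem coeFn_ae_eq_adjoint
    (hU : ∀ (h : F) (s : I),
      h s = inner ℝ (D.feature s) (U h : EuclideanSpace ℝ (Fin D.n₀ × Fin D.J)))
    (h : F) : ⇑h =ᵐ[D.rho] (analysis hD hZ).adjoint (U h) :=
  (EventuallyEq.of_eq (funext (hU h))).trans (coeFn_adjoint_analysis hD hZ _).symm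

theorem coeFn_ae_eq_iff
    (hU : ∀ (h : F) (s : I),
      h s = inner ℝ (D.feature s) (U h : EuclideanSpace ℝ (Fin D.n₀ × Fin D.J)))
    (h : F) (φ : D.L2rho) : ⇑h =ᵐ[D.rho] φ ↔ (analysis hD hZ).adjoint (U h) = φ := by
  constructor
  · exact fun hφ => Lp.ext ((coeFn_ae_eq_adjoint hD hZ hU h).symm.trans hφ)
  · rintro rfl
    exact coeFn_ae_eq_adjoint hD hZ hU h

theorem analysis_mem_span (φ : D.L2rho) :
    analysis hD hZ φ ∈ Submodule.span ℝ (Set.range D.feature) :=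
  range_analysis_le hD hZ ⟨φ, rfl⟩

variable {T : D.L2rho →L[ℝ] D.L2rho}

theorem mem_range_iff_exists_ae_eq (hT : T.IsPositive)
    (hTT : T ∘L T = (analysis hD hZ).adjoint ∘L analysis hD hZ)
    (hU : ∀ (h : F) (s : I),
      h s = inner ℝ (D.feature s) (U h : EuclideanSpace ℝ (Fin D.n₀ × Fin D.J)))
    (φ : D.L2rho) :
    φ ∈ LinearMap.range T.toLinearMap ↔ ∃ h : F, ⇑h =ᵐ[D.rho] φ := by
  rw [range_eq_range_adjoint hT hTT]
  simp only [coeFn_ae_eq_iff hD hZ hU]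
  constructor
  · rintro ⟨c, rfl⟩
    -- The vector c may lie outside the span of the features; Aa lies inside and has the same image
    -- under A*.
    obtain ⟨a, ha⟩ := exists_adjoint_apply_self (analysis hD hZ) c
    refine ⟨U.symm ⟨_, analysis_mem_span hD hZ a⟩, ?_⟩
    rw [U.apply_symm_apply]
    exact ha
  · rintro ⟨h, rfl⟩
    exact ⟨_, rfl⟩

theorem isLeast_rangeInner (hT : T.IsPositive)
    (hTT : T ∘L T = (analysis hD hZ).adjoint ∘L analysis hD hZ)
    (hU : ∀ (h : F) (s : I),
      h s = inner ℝ (D.feature s) (U h : EuclideanSpace ℝ (Fin D.n₀ × Fin D.J)))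
    {φ : D.L2rho} (hφ : φ ∈ LinearMap.range T.toLinearMap) :
    IsLeast {r : ℝ | ∃ h : F, ⇑h =ᵐ[D.rho] φ ∧ r = inner ℝ h h} (rangeInner T φ φ) := by
  rw [range_eq_range_adjoint hT hTT] at hφ
  obtain ⟨c, rfl⟩ := hφ
  obtain ⟨a, ha⟩ := exists_adjoint_apply_self (analysis hD hZ) c
  simp only [coeFn_ae_eq_iff hD hZ hU, coe_coe, ← ha, rangeInner_adjoint_apply hT hTT]
  constructor
  · refine ⟨U.symm ⟨_, analysis_mem_span hD hZ a⟩, ?_, ?_⟩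
    · rw [U.apply_symm_apply]
    · rw [U.symm.inner_map_map]
      rfl
  · rintro _ ⟨h, hh, rfl⟩
    rw [← U.inner_map_map, Submodule.coe_inner]
    -- Any other representative differs from Aa by an element of N(A*), orthogonal to ran A;
    -- Pythagoras gives minimality.
    have horth : inner ℝ ((U h : EuclideanSpace ℝ _) - analysis hD hZ a) (analysis hD hZ a) = 0 := by
      rw [← adjoint_inner_left, map_sub, hh, sub_self, inner_zero_left]
    have h1 := norm_add_sq_real ((U h : EuclideanSpace ℝ _) - analysis hD hZ a) (analysis hD hZ a)
    rw [horth, sub_add_cancel] at h1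
    rw [real_inner_self_eq_norm_sq, real_inner_self_eq_norm_sq, h1]
    nlinarith [sq_nonneg ‖(U h : EuclideanSpace ℝ _) - analysis hD hZ a‖]

theorem eq_of_ae_eq_of_continuous [CompleteSpace F] (hD : D.UniformlyBounded) (hZ : 0 < D.Z)
    (hF : IsRKHSOf F D.Gbar)
    (hc : ∀ k j, Continuous (D.g (D.u k) (D.x j))) {h h' : F} (hh : ⇑h =ᵐ[D.rho] ⇑h') :
    h = h' := by
  obtain ⟨U, hU⟩ := exists_isometry_span_feature hZ hF
  ext s
  rw [hU, hU, ← sub_eq_zero, ← inner_sub_right]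
  refine feature_inner_eq_zero_of_continuous hD hZ hc ?_ s
  filter_upwards [hh] with s hs
  rw [inner_sub_right, ← hU, ← hU, hs, sub_self]

theorem inner_eq_rangeInner_of_continuous [CompleteSpace F] (hT : T.IsPositive)
    (hTT : T ∘L T = (analysis hD hZ).adjoint ∘L analysis hD hZ) (hF : IsRKHSOf F D.Gbar)
    (hc : ∀ k j, Continuous (D.g (D.u k) (D.x j))) {h h' : F} {φ φ' : D.L2rho}
    (hφ : ⇑h =ᵐ[D.rho] φ) (hφ' : ⇑h' =ᵐ[D.rho] φ') : inner ℝ h h' = rangeInner T φ φ' := by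
  obtain ⟨U, hU⟩ := exists_isometry_span_feature hZ hF
  -- By continuity a class has only one representative in F, so `U f` must be the one in ran A.
  have key (f : F) : ∃ a, (U f : EuclideanSpace ℝ _) = analysis hD hZ a := by
    obtain ⟨a, ha⟩ := exists_adjoint_apply_self (analysis hD hZ) (U f)
    refine ⟨a, ?_⟩
    have hf : f = U.symm ⟨_, analysis_mem_span hD hZ a⟩ := by
      refine eq_of_ae_eq_of_continuous hD hZ hF hc
        (((coeFn_ae_eq_iff hD hZ hU _ _).mpr ha.symm).trans
        ((coeFn_ae_eq_iff hD hZ hU _ _).mpr ?_).symm)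
      rw [U.apply_symm_apply]
    rw [hf, U.apply_symm_apply]
  rw [coeFn_ae_eq_iff hD hZ hU] at hφ hφ'
  obtain ⟨a, ha⟩ := key h
  obtain ⟨a', ha'⟩ := key h'
  rw [← hφ, ← hφ', ha, ha', rangeInner_adjoint_apply hT hTT, ← U.inner_map_map, Submodule.coe_inner,
    ha, ha']

end RKHS

end Observation

end KernelLearning

end

/-! ### Assembly of the theorem -/

open KernelLearning in
theorem mainTheorem1 {𝕏 : Type*} (D : Observation 𝕏) (hD : D.UniformlyBounded) (hZ : 0 < D.Z) :
    -- the forward operator is well defined on `L²_ρ`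
    (∀ φ : I → ℝ, MemLp φ 2 D.rho → ∀ k j,
      Integrable (fun s => φ s * D.g (D.u k) (D.x j) s) volume) ∧
    (∀ φ φ' : I → ℝ, φ =ᵐ[D.rho] φ' → ∀ k j,
      D.R φ (D.u k) (D.x j) = D.R φ' (D.u k) (D.x j)) ∧
    -- (a) the kernel is square integrable and symmetric
    MemLp (fun p : I × I => D.Gbar p.1 p.2) 2 (D.rho.prod D.rho) ∧
    (∀ s s', D.Gbar s s' = D.Gbar s' s) ∧
    ∃ L : D.L2rho →L[ℝ] D.L2rho,
      -- `L` is the integral operator of the kernel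
      (∀ φ : D.L2rho, (∀ s, Integrable (fun s' => φ s' * D.Gbar s s') D.rho) ∧
        L φ =ᵐ[D.rho] D.integralOp φ) ∧
      IsCompactOperator L ∧ IsSelfAdjoint L ∧ L.IsPositive ∧
      -- nonnegative eigenvalues, complete orthonormal basis of eigenfunctions
      (∀ μ : ℝ, Module.End.HasEigenvalue L.toLinearMap μ → 0 ≤ μ) ∧
      (∃ (ι : Type) (_ : Countable ι) (ψ : HilbertBasis ι ℝ D.L2rho) (ev : ι → ℝ),
        ∀ i, L (ψ i) = ev i • ψ i) ∧
      -- for each such basis, the closed span of the `ψ i` with positive eigenvalue is `N(L)^⊥`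
      (∀ (ι : Type) (ψ : HilbertBasis ι ℝ D.L2rho) (ev : ι → ℝ),
        (∀ i, L (ψ i) = ev i • ψ i) →
        (Submodule.span ℝ {φ | ∃ i, 0 < ev i ∧ φ = ψ i}).topologicalClosure =
          (LinearMap.ker L.toLinearMap)ᗮ) ∧
      -- (b) the loss function
      (∀ f : Fin D.n₀ → ℝ → ℝ, ∃ φD : D.L2rho,
        (∀ φ : D.L2rho, inner ℝ φD φ =
          (1 / (D.n₀ : ℝ)) * ∑ k, ∫ x, D.R φ (D.u k) x * f k x ∂D.nu) ∧
        (∃ c : ℝ, ∀ φ : D.L2rho,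
          D.loss f φ = inner ℝ (L φ) φ - 2 * inner ℝ φD φ + c) ∧
        -- noiseless data
        ∀ φs : D.L2rho,
          (∀ k j, f k (D.x j) = D.R φs (D.u k) (D.x j)) →
          φD = L φs ∧
          L ((LinearMap.ker L.toLinearMap)ᗮ.starProjection φs) = φD ∧
          pinv L φD = (LinearMap.ker L.toLinearMap)ᗮ.starProjection φs ∧
          IsMinOn (fun φ : D.L2rho => D.loss f φ) ((LinearMap.ker L.toLinearMap)ᗮ : Set D.L2rho)
            ((LinearMap.ker L.toLinearMap)ᗮ.starProjection φs) ∧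
          ∀ φ ∈ (LinearMap.ker L.toLinearMap)ᗮ,
            IsMinOn (fun φ : D.L2rho => D.loss f φ)
              ((LinearMap.ker L.toLinearMap)ᗮ : Set D.L2rho) φ →
            φ = (LinearMap.ker L.toLinearMap)ᗮ.starProjection φs) ∧
      -- (c) `T = L^{1/2}`
      ∃ T : D.L2rho →L[ℝ] D.L2rho, T.IsPositive ∧ T ∘L T = L ∧
        -- the RKHS of the kernel exists, and modulo `ρ`-null sets it is `T(L²_ρ)`
        (∃ (F : Type) (_ : NormedAddCommGroup F) (_ : InnerProductSpace ℝ F)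
          (_ : CompleteSpace F) (_ : RKHS ℝ F I ℝ), IsRKHSOf F D.Gbar) ∧
        (∀ (F : Type) [NormedAddCommGroup F] [InnerProductSpace ℝ F] [CompleteSpace F]
          [RKHS ℝ F I ℝ], IsRKHSOf F D.Gbar →
          (∀ h : F, MemLp (fun s => h s) 2 D.rho) ∧
          (∀ φ : D.L2rho, φ ∈ LinearMap.range T.toLinearMap ↔ ∃ h : F, ⇑h =ᵐ[D.rho] φ) ∧
          (∀ φ ∈ LinearMap.range T.toLinearMap,
            IsLeast {r : ℝ | ∃ h : F, ⇑h =ᵐ[D.rho] φ ∧ r = inner ℝ h h} (rangeInner T φ φ)) ∧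
          -- for continuous data the identification is one-to-one and isometric
          ((∀ k j, Continuous (D.g (D.u k) (D.x j))) →
            (∀ h h' : F, ⇑h =ᵐ[D.rho] ⇑h' → h = h') ∧
            (∀ (h h' : F) (φ φ' : D.L2rho), ⇑h =ᵐ[D.rho] φ → ⇑h' =ᵐ[D.rho] φ' →
              inner ℝ h h' = rangeInner T φ φ'))) ∧
        -- the closure of the RKHS in `L²_ρ`, and the inner product identity
        (LinearMap.range T.toLinearMap).topologicalClosure = (LinearMap.ker L.toLinearMap)ᗮ ∧
        (∀ φ ∈ LinearMap.range T.toLinearMap, ∀ ψ : D.L2rho,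
          L ψ ∈ LinearMap.range T.toLinearMap ∧ rangeInner T φ (L ψ) = inner ℝ φ ψ) := by
  set A := Observation.analysis hD hZ with hA
  have := Observation.isFiniteMeasure_rho hD hZ
  have : Fact ((2 : ℝ≥0∞) ≠ ∞) := ⟨ENNReal.ofNat_ne_top⟩
  have hpos : (A.adjoint ∘L A).IsPositive := by
    simpa using ContinuousLinearMap.isPositive_self_comp_adjoint A.adjoint
  have hcomp := isCompactOperator_adjoint_comp_self A
  have hAL {φ ψ : D.L2rho} (h : (A.adjoint ∘L A) φ = (A.adjoint ∘L A) ψ) : A φ = A ψ := by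
    have hk : φ - ψ ∈ (A.adjoint ∘L A).ker := by
      rw [LinearMap.mem_ker, map_sub, sub_eq_zero]
      exact h
    rw [A.ker_adjoint_comp_self, LinearMap.mem_ker, map_sub, sub_eq_zero] at hk
    exact hk
  obtain ⟨T, hT, hTT⟩ := exists_isPositive_comp_self_eq A
  have hker := ker_eq_ker_comp_self hT
  rw [hTT] at hker
  refine ⟨fun φ hφ k j => Observation.integrable_mul_slice hD hZ hφ (k, j), fun φ φ' h k j => ?_,
    Observation.memLp_Gbar hD hZ, fun s s' => ?_, A.adjoint ∘L A,
    fun φ => ⟨Observation.integrable_mul_Gbar hD hZ (Lp.memLp φ),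
      Observation.coeFn_adjoint_comp_self_analysis hD hZ φ⟩,
    hcomp, hpos.isSelfAdjoint, hpos, fun μ hμ => ?_, exists_eigenbasis hcomp hpos.isSymmetric,
    fun ι ψ ev h => closure_span_pos_eigenvectors hpos ψ ev h, fun f => ?_, T, hT, hTT,
    Observation.exists_isRKHSOf_Gbar hZ, ?_, (closure_range_eq hT).trans (by rw [hker]), ?_⟩
  · rw [Observation.R_eq_integral hD hZ φ (k, j), Observation.R_eq_integral hD hZ φ' (k, j)]
    exact integral_congr_ae (h.mono fun s hs => by dsimp only; rw [hs])
  · rw [Observation.Gbar_eq hZ, Observation.Gbar_eq hZ, real_inner_comm]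
  · exact eigenvalue_nonneg_of_nonneg hμ fun x => hpos.re_inner_nonneg_right x
  · have hloss := Observation.loss_eq hD hZ f
    refine ⟨A.adjoint (D.outputs f), fun φ => ?_, ⟨‖D.outputs f‖ ^ 2, fun φ => ?_⟩,
      fun φs hφs => ?_⟩
    · rw [ContinuousLinearMap.adjoint_inner_left]
      exact Observation.inner_outputs_analysis hD hZ f φ
    · rw [hloss]
      exact norm_apply_sub_sq A _ φ
    · have hproj := apply_starProjection_orthogonal_ker (A.adjoint ∘L A) φs
      have hy : D.outputs f = A φs := Observation.outputs_eq_analysis hD hZ hφs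
      have hmem := Submodule.starProjection_apply_mem
        (LinearMap.ker (A.adjoint ∘L A).toLinearMap)ᗮ φs
      -- For noiseless data the minimum is 0, so every minimizer φ satisfies Aφ = Aφ_*, which fixes
      -- it in `N(L)^⊥`.
      have hmin : D.loss f ((LinearMap.ker (A.adjoint ∘L A).toLinearMap)ᗮ.starProjection φs) = 0 := by
        rw [hloss, ← hA, hAL hproj, hy, sub_self, norm_zero, zero_pow two_ne_zero]
      rw [hy]
      refine ⟨rfl, hproj, ?_, fun φ _ => ?_, fun φ hφ hφm => ?_⟩
      · exact (congrArg _ hproj.symm).trans (pinv_apply_of_mem hmem)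
      · change D.loss f _ ≤ D.loss f φ
        rw [hmin, hloss]
        positivity
      · have h0 : D.loss f φ ≤ 0 := hmin ▸ hφm hmem
        rw [hloss, ← hA, hy] at h0
        have h1 : A φ = A φs := by
          rw [← sub_eq_zero, ← norm_eq_zero]
          exact pow_eq_zero_iff two_ne_zero |>.mp (le_antisymm h0 (sq_nonneg _))
        exact eq_starProjection_of_apply_eq (A.adjoint ∘L A) hφ (congrArg A.adjoint h1)
  · intro F _ _ _ _ hF
    obtain ⟨U, hU⟩ := Observation.exists_isometry_span_feature hZ hF
    exact ⟨fun h => (memLp_congr_ae (Observation.coeFn_ae_eq_adjoint hD hZ hU h)).mpr (Lp.memLp _),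
      Observation.mem_range_iff_exists_ae_eq hD hZ hT hTT hU,
      fun φ hφ => Observation.isLeast_rangeInner hD hZ hT hTT hU hφ,
      fun hc => ⟨fun h h' => Observation.eq_of_ae_eq_of_continuous hD hZ hF hc,
        fun h h' φ φ' => Observation.inner_eq_rangeInner_of_continuous hD hZ hT hTT hF hc⟩⟩
  · intro φ hφ ψ
    rw [← hTT]
    exact ⟨⟨T ψ, rfl⟩, rangeInner_comp_self hT hφ ψ⟩
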